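/- Let $\Omega\subset\mathbb R^d$ be compact and convex, and let $\mu,\nu$ be Borel probability measures on $\Omega$ that are absolutely continuous with respect to the Lebesgue measure. For $f:\Omega\to\mathbb R$ let $f^c(x)=\inf_{y\in\Omega}\{\tfrac12\|x-y\|_2^2-f(y)\}$ be its $c$-transform, let $\mathcal I(f)=\int_\Omega f\,d\mu+\int_\Omega f^c\,d\nu$ be the Kantorovich dual functional, and let $T_h=\mathrm{id}-\nabla h$. A real function on $\Omega$ is $c$-concave if it equals $g^c$ for some $g:\Omega\to\mathbb R$. Let $\langle f,g\rangle_{\dot{\mathbb H}^1}=\int_\Omega\langle\nabla f,\nabla g\rangle\,dx$ and $\|f\|_{\dot{\mathbb H}^1}=\langle f,f\rangle_{\dot{\mathbb H}^1}^{1/2}$ with weak gradients, and let $\dot{\mathbb H}^1$ be the space of integrable functions $f$ on $\Omega$ with $\int_\Omega f\,dx=0$ and $\|f\|_{\dot{\mathbb H}^1}<\infty$. For finite measures put $\|\mu-\sigma\|_{\dot{\mathbb H}^{-1}}=\sup\{\int_\Omega\phi\,d[\mu-\sigma]:\phi\in\dot{\mathbb H}^1\text{ continuous on }\Omega,\ \|\phi\|_{\dot{\mathbb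 H}^1}\le 1\}$. The $\dot{\mathbb H}^1$-gradient $\boldsymbol\nabla\mathcal I(f)\in\dot{\mathbb H}^1$ at a continuous $f$, where it exists, is the element for which $\langle\boldsymbol\nabla\mathcal I(f),h\rangle_{\dot{\mathbb H}^1}$ is the Gateaux derivative of $\mathcal I$ at $f$ in direction $h$, for every continuous $h\in\dot{\mathbb H}^1$. **Theorem (convergence rate for unconstrained Sobolev gradient ascent).** Let $T\ge 1$, let $\eta_0,\dots,\eta_{T-1}\ge 0$ be step sizes with $\sum_{t=1}^T\eta_{t-1}>0$, and let $f^{(0)},\dots,f^{(T)}$ be continuous functions on $\Omega$ such that $\|f^{(0)}\|_{\dot{\mathbb H}^1}<\infty$ and, for $t=1,\dots,T$, the gradient $\boldsymbol\nabla\mathcal I(f^{(t-1)})$ exists and $$f^{(t)}=f^{(t-1)}+\eta_{t-1}\boldsymbol\nabla\mathcal I(f^{(t-1)})$$ almost everywhere on $\Omega$ (no double $c$-transform is applied). Let $\tilde f$ be any $c$-concave maximizer of $\mathcal I$ among the $c$-concave functions, and let $f^{(\mathrm{best})}$ be such that $\mathcal I(f^{(\mathrm{best})})\ge\max_{1\le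 t\le T}\mathcal I(f^{(t-1)})$. Then $M:=\max_{1\le t\le T}\|\mu-(T_{(f^{(t-1)})^c})_\#\nu\|_{\dot{\mathbb H}^{-1}}$ is finite and $$\mathcal I(\tilde f)-\mathcal I(f^{(\mathrm{best})})\le\frac{\|f^{(0)}-\tilde f\|_{\dot{\mathbb H}^1}^2+M^2\sum_{t=1}^T\eta_{t-1}^2}{2\sum_{t=1}^T\eta_{t-1}}.$$ -/

import Mathlib

open MeasureTheory
open scoped ENNReal ContDiff

noncomputable section

namespace SGA

variable {d : ℕ}

/-- The `c`-transform on `Ω` for the quadratic cost `c(x, y) = ‖x - y‖² / 2`: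
`f^c(x) = inf_{y ∈ Ω} (‖x - y‖² / 2 - f y)`. Only the values of `f` on `Ω` enter. -/
def cTransform (Ω : Set (EuclideanSpace ℝ (Fin d))) (f : EuclideanSpace ℝ (Fin d) → ℝ)
    (x : EuclideanSpace ℝ (Fin d)) : ℝ :=
  sInf ((fun y => ‖x - y‖ ^ 2 / 2 - f y) '' Ω)

/-- `f` is `c`-concave on `Ω`: it is the `c`-transform of some function `g` on `Ω`. As `Ω` is
bounded, the `c`-transform of `g` is finite exactly if `g` is bounded above on `Ω`. -/
def IsCConcave (Ω : Set (EuclideanSpace ℝ (Fin d))) (f : EuclideanSpace ℝ (Fin d) → ℝ) : Prop :=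
  ∃ g : EuclideanSpace ℝ (Fin d) → ℝ, BddAbove (g '' Ω) ∧ ∀ x ∈ Ω, f x = cTransform Ω g x

/-- The Kantorovich dual functional `𝓘(f) = ∫_Ω f dμ + ∫_Ω f^c dν`. -/
def kantorovichDual (Ω : Set (EuclideanSpace ℝ (Fin d)))
    (μ ν : Measure (EuclideanSpace ℝ (Fin d))) (f : EuclideanSpace ℝ (Fin d) → ℝ) : ℝ :=
  (∫ x in Ω, f x ∂μ) + ∫ x in Ω, cTransform Ω f x ∂ν

/-- `f` is a maximizer of the Kantorovich dual functional among all `c`-concave functions, and is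
itself `c`-concave. -/
def IsCConcaveMaximizer (Ω : Set (EuclideanSpace ℝ (Fin d)))
    (μ ν : Measure (EuclideanSpace ℝ (Fin d))) (f : EuclideanSpace ℝ (Fin d) → ℝ) : Prop :=
  IsCConcave Ω f ∧
    ∀ h, IsCConcave Ω h → kantorovichDual Ω μ ν h ≤ kantorovichDual Ω μ ν f

/-- The map `T_h = id - ∇h`. -/
def otMap (h : EuclideanSpace ℝ (Fin d) → ℝ) (x : EuclideanSpace ℝ (Fin d)) :
    EuclideanSpace ℝ (Fin d) :=
  x - gradient h x

/-- `f` is integrable on `Ω` and `G` is a weak (distributional) gradient of `f` in the interior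
of `Ω` that is square-integrable on `Ω`. -/
structure HasL2WeakGradient (Ω : Set (EuclideanSpace ℝ (Fin d)))
    (f : EuclideanSpace ℝ (Fin d) → ℝ)
    (G : EuclideanSpace ℝ (Fin d) → EuclideanSpace ℝ (Fin d)) : Prop where
  integrableOn : IntegrableOn f Ω volume
  memLp : MemLp G 2 (volume.restrict Ω)
  integral_eq : ∀ φ : EuclideanSpace ℝ (Fin d) → ℝ, ContDiff ℝ ∞ φ → HasCompactSupport φ →
    tsupport φ ⊆ interior Ω → ∀ v : EuclideanSpace ℝ (Fin d),
      ∫ x in Ω, f x * fderiv ℝ φ x v = -∫ x in Ω, φ x * inner ℝ (G x) v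

/-- `f` has a square-integrable weak gradient on `Ω`, that is `‖f‖_{Ḣ¹} < ∞`. -/
def HasFiniteEnergy (Ω : Set (EuclideanSpace ℝ (Fin d)))
    (f : EuclideanSpace ℝ (Fin d) → ℝ) : Prop :=
  ∃ G, HasL2WeakGradient Ω f G

open Classical in
/-- A square-integrable weak gradient of `f` on `Ω` (unique almost everywhere on the interior of
`Ω`), and `0` if there is none. -/
def weakGradient (Ω : Set (EuclideanSpace ℝ (Fin d))) (f : EuclideanSpace ℝ (Fin d) → ℝ) :
    EuclideanSpace ℝ (Fin d) → EuclideanSpace ℝ (Fin d) :=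
  if h : ∃ G, HasL2WeakGradient Ω f G then h.choose else 0

/-- Membership in the homogeneous Sobolev space `Ḣ¹(Ω)` of functions of mean zero with a
square-integrable weak gradient. -/
def MemHdot (Ω : Set (EuclideanSpace ℝ (Fin d))) (f : EuclideanSpace ℝ (Fin d) → ℝ) : Prop :=
  HasFiniteEnergy Ω f ∧ ∫ x in Ω, f x = 0

/-- The inner product `⟨f, g⟩_{Ḣ¹} = ∫_Ω ⟨∇f, ∇g⟩ dx`. -/
def hdotInner (Ω : Set (EuclideanSpace ℝ (Fin d)))
    (f g : EuclideanSpace ℝ (Fin d) → ℝ) : ℝ :=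
  ∫ x in Ω, inner ℝ (weakGradient Ω f x) (weakGradient Ω g x)

/-- The norm `‖f‖_{Ḣ¹} = ⟨f, f⟩_{Ḣ¹}^{1/2}`. It does not change when a constant is added. -/
def hdotNorm (Ω : Set (EuclideanSpace ℝ (Fin d))) (f : EuclideanSpace ℝ (Fin d) → ℝ) : ℝ :=
  Real.sqrt (hdotInner Ω f f)

/-- The dual norm `‖μ - σ‖_{Ḣ⁻¹} = sup {∫_Ω φ d[μ - σ] : ‖φ‖_{Ḣ¹} ≤ 1}` with values in `[0, ∞]`.
As `σ` may be singular, the supremum runs over the continuous functions in `Ḣ¹`, for which the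
integral does not depend on a representative. -/
def hdotDualNorm (Ω : Set (EuclideanSpace ℝ (Fin d)))
    (μ σ : Measure (EuclideanSpace ℝ (Fin d))) : ℝ≥0∞ :=
  ⨆ φ ∈ {φ : EuclideanSpace ℝ (Fin d) → ℝ |
      ContinuousOn φ Ω ∧ MemHdot Ω φ ∧ hdotNorm Ω φ ≤ 1},
    ENNReal.ofReal ((∫ x in Ω, φ x ∂μ) - ∫ x in Ω, φ x ∂σ)

/-- `g` is the `Ḣ¹`-gradient of the Kantorovich dual functional at `f`: `g ∈ Ḣ¹`, and `⟨g, h⟩_{Ḣ¹}`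
is the Gateaux derivative at `f` in each continuous direction `h ∈ Ḣ¹`. -/
structure IsHdotGradient (Ω : Set (EuclideanSpace ℝ (Fin d)))
    (μ ν : Measure (EuclideanSpace ℝ (Fin d)))
    (f g : EuclideanSpace ℝ (Fin d) → ℝ) : Prop where
  memHdot : MemHdot Ω g
  hasDerivAt : ∀ h : EuclideanSpace ℝ (Fin d) → ℝ, ContinuousOn h Ω → MemHdot Ω h →
    HasDerivAt (fun ε : ℝ => kantorovichDual Ω μ ν (fun x => f x + ε * h x)) (hdotInner Ω g h) 0

/-- `f 0, …, f T` are produced by `T` steps of Sobolev gradient ascent with step sizes `η`: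
`f (t + 1) = f t + η t • ∇𝓘(f t)` in `Ḣ¹`, that is, almost everywhere on `Ω`. -/
def IsSobolevAscent (Ω : Set (EuclideanSpace ℝ (Fin d)))
    (μ ν : Measure (EuclideanSpace ℝ (Fin d))) (η : ℕ → ℝ) (T : ℕ)
    (f : ℕ → EuclideanSpace ℝ (Fin d) → ℝ) : Prop :=
  ∀ t < T, ∃ g : EuclideanSpace ℝ (Fin d) → ℝ, IsHdotGradient Ω μ ν (f t) g ∧
    ∀ᵐ x ∂(volume.restrict Ω), f (t + 1) x = f t x + η t * g x

/-- `M = max_{0 ≤ t < T} ‖μ - (T_{(f t)^c})_# ν‖_{Ḣ⁻¹}`. -/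
def ascentBound (Ω : Set (EuclideanSpace ℝ (Fin d)))
    (μ ν : Measure (EuclideanSpace ℝ (Fin d))) (T : ℕ)
    (f : ℕ → EuclideanSpace ℝ (Fin d) → ℝ) : ℝ≥0∞ :=
  (Finset.range T).sup fun t =>
    hdotDualNorm Ω μ (ν.map (otMap (cTransform Ω (f t))))

end SGA

end

/-!
The rate is the one of the classical subgradient method for a concave function on a Hilbert space,
here the space `Ḣ¹`, realized through weak gradients as a part of `L²(Ω; ℝᵈ)` (`gradLp`).

Writing `σ` for the push-forward of `ν` under `otMap (f^c)`, two facts have to be supplied.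

*The gradient of the dual functional at `f` represents `μ - σ`.* The `c`-transform `f^c` is
`‖x‖² / 2` plus a Lipschitz function, hence differentiable almost everywhere, and where it is, the
infimum defining `f^c x` is attained exactly at `y = otMap (f^c) x` (`ae_otMap_cTransform`). Using
this `y` as a competitor in `k^c x` shows that `k - f ↦ ∫ (k - f) d[μ - σ]` is a supergradient of
the dual functional at `f` (`kantorovichDual_sub_le`). A function that has a supergradient and a
Gateaux derivative has the former as the latter (`IsHdotGradient.hdotInner_eq`), so no
differentiation under the integral is needed.

*Its `Ḣ¹`-norm is the dual norm of `μ - σ`.* Cauchy–Schwarz bounds the dual norm by the norm of the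
gradient, so the dual norm is finite. The converse needs a continuous representative of the
gradient, as the dual norm only tests continuous functions; for a positive step size it is
`(f (t + 1) - f t) / η t`.

The `c`-concave maximizer is Lipschitz on `Ω`, hence by Rademacher's theorem of finite energy
(`IsCConcave.hasFiniteEnergy`) and an admissible comparison function. Expanding
`‖f (t + 1) - fOpt‖² = ‖f t - fOpt‖² + 2 η t ⟪g, f t - fOpt⟫ + (η t)² ‖g‖²` and bounding the two last
terms by the supergradient inequality (`IsHdotGradient.kantorovichDual_sub_le_inner`) and by the
dual norm, the sum over `t` telescopes.
-/

namespace SGA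

variable {d : ℕ} {Ω : Set (EuclideanSpace ℝ (Fin d))} {f k : EuclideanSpace ℝ (Fin d) → ℝ}

/-! ### The `c`-transform -/

lemma cTransform_le (hf : BddAbove (f '' Ω)) {x y : EuclideanSpace ℝ (Fin d)} (hy : y ∈ Ω) :
    cTransform Ω f x ≤ ‖x - y‖ ^ 2 / 2 - f y := by
  obtain ⟨B, hB⟩ := hf
  refine csInf_le ⟨-B, ?_⟩ ⟨y, hy, rfl⟩
  rintro _ ⟨z, hz, rfl⟩
  have hfz := hB ⟨z, hz, rfl⟩
  have := sq_nonneg ‖x - z‖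
  dsimp only
  linarith

/-- The `c`-transform is `‖x‖² / 2` plus an infimum of the affine functions
`x ↦ ‖y‖² / 2 - f y - ⟪x, y⟫`, whose slopes `y ∈ Ω` are bounded. -/
lemma lipschitzWith_cTransform_sub_sq {R : NNReal} (hne : Ω.Nonempty) (hR : ∀ y ∈ Ω, ‖y‖ ≤ R)
    (hf : BddAbove (f '' Ω)) :
    LipschitzWith R (fun x => cTransform Ω f x - ‖x‖ ^ 2 / 2) := by
  refine LipschitzWith.of_le_add_mul R fun x x' => ?_
  suffices h : cTransform Ω f x - (‖x‖ ^ 2 / 2 - ‖x'‖ ^ 2 / 2) - R * dist x x' ≤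
      cTransform Ω f x' by linarith
  refine le_csInf (hne.image _) ?_
  rintro _ ⟨y, hy, rfl⟩
  have h1 := cTransform_le hf (x := x) hy
  have h2 : inner ℝ (x' - x) y ≤ R * dist x x' := by
    refine (real_inner_le_norm _ _).trans ?_
    rw [dist_comm, dist_eq_norm, mul_comm]
    gcongr
    exact hR y hy
  have h3 := norm_sub_sq_real x y
  have h4 := norm_sub_sq_real x' y
  rw [inner_sub_left] at h2
  dsimp only
  linarith

lemma exists_norm_le_of_isCompact (hΩ : IsCompact Ω) : ∃ R : NNReal, ∀ y ∈ Ω, ‖y‖ ≤ R := by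
  obtain ⟨R, hR⟩ := hΩ.isBounded.exists_norm_le
  exact ⟨R.toNNReal, fun y hy => (hR y hy).trans (Real.le_coe_toNNReal R)⟩

lemma continuous_cTransform (hΩ : IsCompact Ω) (hne : Ω.Nonempty) (hf : BddAbove (f '' Ω)) :
    Continuous (cTransform Ω f) := by
  obtain ⟨R, hR⟩ := exists_norm_le_of_isCompact hΩ
  refine ((lipschitzWith_cTransform_sub_sq hne hR hf).continuous.add
    ((continuous_norm.pow 2).div_const (2 : ℝ))).congr fun x => ?_
  simp

lemma ae_differentiableAt_cTransform (hΩ : IsCompact Ω) (hne : Ω.Nonempty)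
    (hf : BddAbove (f '' Ω)) :
    ∀ᵐ x ∂(volume : Measure (EuclideanSpace ℝ (Fin d))),
      DifferentiableAt ℝ (cTransform Ω f) x := by
  obtain ⟨R, hR⟩ := exists_norm_le_of_isCompact hΩ
  filter_upwards [(lipschitzWith_cTransform_sub_sq hne hR hf).ae_differentiableAt
    (μ := volume)] with x hx
  have hsq : DifferentiableAt ℝ (fun z : EuclideanSpace ℝ (Fin d) => ‖z‖ ^ 2 / 2) x := by
    simpa only [id, div_eq_mul_inv] using (differentiableAt_id.norm_sq ℝ).mul_const (2 : ℝ)⁻¹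
  refine (hx.add hsq).congr_of_eventuallyEq (Filter.Eventually.of_forall fun z => ?_)
  simp

lemma lipschitzOnWith_cTransform {R : NNReal} (hne : Ω.Nonempty) (hR : ∀ y ∈ Ω, ‖y‖ ≤ R)
    (hf : BddAbove (f '' Ω)) : LipschitzOnWith (2 * R) (cTransform Ω f) Ω := by
  refine LipschitzOnWith.of_dist_le_mul fun x hx x' hx' => ?_
  have h1 := (lipschitzWith_cTransform_sub_sq hne hR hf).dist_le_mul x x'
  have h2 : |‖x‖ ^ 2 / 2 - ‖x'‖ ^ 2 / 2| ≤ R * dist x x' := by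
    have e : ‖x‖ ^ 2 / 2 - ‖x'‖ ^ 2 / 2 = (‖x‖ + ‖x'‖) / 2 * (‖x‖ - ‖x'‖) := by ring
    rw [e, abs_mul, dist_eq_norm]
    gcongr
    · rw [abs_of_nonneg (by positivity)]
      linarith [hR x hx, hR x' hx']
    · exact abs_norm_sub_norm_le x x'
  rw [Real.dist_eq] at h1 ⊢
  have e : cTransform Ω f x - cTransform Ω f x' =
      (cTransform Ω f x - ‖x‖ ^ 2 / 2 - (cTransform Ω f x' - ‖x'‖ ^ 2 / 2)) +
        (‖x‖ ^ 2 / 2 - ‖x'‖ ^ 2 / 2) := by ring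
  rw [e]
  refine (abs_add_le _ _).trans ((add_le_add h1 h2).trans_eq ?_)
  push_cast
  ring

/-- A `c`-concave function agrees on `Ω` with a Lipschitz function on the whole space. -/
lemma IsCConcave.exists_lipschitzWith (hΩ : IsCompact Ω) (hne : Ω.Nonempty)
    (hf : IsCConcave Ω f) : ∃ (C : NNReal) (F : EuclideanSpace ℝ (Fin d) → ℝ),
      LipschitzWith C F ∧ Set.EqOn f F Ω := by
  obtain ⟨g, hg, hfg⟩ := hf
  obtain ⟨R, hR⟩ := exists_norm_le_of_isCompact hΩ
  obtain ⟨F, hF, hFg⟩ := (lipschitzOnWith_cTransform hne hR hg).extend_real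
  exact ⟨_, F, hF, fun x hx => (hfg x hx).trans (hFg hx)⟩

/-! ### The optimal transport map -/

/-- By the first-order condition, `otMap (f^c) x` is the only point at which the infimum defining
`f^c x` can be attained, if `f^c` is differentiable at `x`. -/
lemma otMap_cTransform_eq (hf : BddAbove (f '' Ω)) {x y : EuclideanSpace ℝ (Fin d)} (hy : y ∈ Ω)
    (hxy : cTransform Ω f x = ‖x - y‖ ^ 2 / 2 - f y)
    (hd : DifferentiableAt ℝ (cTransform Ω f) x) : otMap (cTransform Ω f) x = y := by
  have hmin : IsLocalMin (fun z => ‖z - y‖ ^ 2 / 2 - f y - cTransform Ω f z) x :=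
    Filter.Eventually.of_forall fun z => by
      have := cTransform_le hf (x := z) hy
      dsimp only
      linarith
  have hsq : HasFDerivAt (fun z : EuclideanSpace ℝ (Fin d) => ‖z - y‖ ^ 2)
      (2 • innerSL ℝ (x - y)) x := by
    simpa using ((hasFDerivAt_id x).sub_const y).norm_sq
  have hder : HasFDerivAt (fun z => ‖z - y‖ ^ 2 / 2 - f y - cTransform Ω f z)
      ((2 : ℝ)⁻¹ • (2 • innerSL ℝ (x - y)) - fderiv ℝ (cTransform Ω f) x) x := by
    simp only [div_eq_inv_mul]
    exact ((hsq.const_mul (2 : ℝ)⁻¹).sub_const (f y)).sub hd.hasFDerivAt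
  have h0 := hmin.hasFDerivAt_eq_zero hder
  have hgrad : x - y = gradient (cTransform Ω f) x := by
    refine ext_inner_right ℝ fun v => ?_
    have := congrArg (fun l => l v) h0
    simp only [sub_apply, smul_apply, innerSL_apply_apply,
      zero_apply, smul_eq_mul, nsmul_eq_mul] at this
    rw [inner_gradient_left]
    push_cast at this
    linarith
  rw [otMap, ← hgrad]
  abel

lemma ae_otMap_cTransform (hΩ : IsCompact Ω) (hne : Ω.Nonempty) (hf : ContinuousOn f Ω) :
    ∀ᵐ x ∂(volume : Measure (EuclideanSpace ℝ (Fin d))),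
      otMap (cTransform Ω f) x ∈ Ω ∧ cTransform Ω f x =
        ‖x - otMap (cTransform Ω f) x‖ ^ 2 / 2 - f (otMap (cTransform Ω f) x) := by
  have hb := hΩ.bddAbove_image hf
  filter_upwards [ae_differentiableAt_cTransform hΩ hne hb] with x hx
  have hcont : ContinuousOn (fun y => ‖x - y‖ ^ 2 / 2 - f y) Ω :=
    Continuous.continuousOn (by fun_prop) |>.sub hf
  obtain ⟨y, hy, hmin⟩ := hΩ.exists_isMinOn hne hcont
  have hxy : cTransform Ω f x = ‖x - y‖ ^ 2 / 2 - f y := by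
    refine le_antisymm (cTransform_le hb hy) (le_csInf (hne.image _) ?_)
    rintro _ ⟨z, hz, rfl⟩
    exact hmin hz
  rw [otMap_cTransform_eq hb hy hxy hx]
  exact ⟨hy, hxy⟩

lemma measurable_gradient (f : EuclideanSpace ℝ (Fin d) → ℝ) : Measurable (gradient f) :=
  (InnerProductSpace.toDual ℝ (EuclideanSpace ℝ (Fin d))).symm.continuous.measurable.comp
    (measurable_fderiv ℝ f)

lemma measurable_otMap (f : EuclideanSpace ℝ (Fin d) → ℝ) : Measurable (otMap f) :=
  measurable_id.sub (measurable_gradient f)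

/-! ### First-order behaviour of the dual functional -/

variable {μ ν : Measure (EuclideanSpace ℝ (Fin d))}

/-- `∫_Ω k dσ = ∫_Ω k ∘ T dν` for the push-forward `σ` of `ν` under `T = otMap (f^c)`, with
integrability: `T` sends almost every point into `Ω`. -/
lemma integral_map_otMap (hΩ : IsCompact Ω) (hne : Ω.Nonempty) [IsFiniteMeasure ν]
    (hνΩ : ν Ωᶜ = 0) (hν : ν ≪ volume) (hf : ContinuousOn f Ω) (hk : ContinuousOn k Ω) :
    IntegrableOn (fun x => k (otMap (cTransform Ω f) x)) Ω ν ∧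
    ∫ x in Ω, k x ∂(ν.map (otMap (cTransform Ω f))) =
      ∫ x in Ω, k (otMap (cTransform Ω f) x) ∂ν := by
  set S := otMap (cTransform Ω f)
  have hS : Measurable S := measurable_otMap _
  have hmem : ∀ᵐ x ∂ν, S x ∈ Ω := by
    filter_upwards [hν.ae_le (ae_otMap_cTransform hΩ hne hf)] with x hx using hx.1
  have hΩae : ∀ᵐ x ∂ν, x ∈ Ω := by rw [ae_iff]; exact hνΩ
  have hae : (ν.restrict (S ⁻¹' Ω)) = ν.restrict Ω :=
    Measure.restrict_congr_set <| by
      filter_upwards [hmem, hΩae] with x h1 h2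
      exact propext ⟨fun _ => h2, fun _ => h1⟩
  have hrestr : (ν.map S).restrict Ω = (ν.restrict Ω).map S := by
    rw [Measure.restrict_map hS hΩ.measurableSet, hae]
  have hint : Integrable k ((ν.restrict Ω).map S) := by
    rw [← hrestr]
    have : IsFiniteMeasure (ν.map S) := Measure.isFiniteMeasure_map ν S
    exact hk.integrableOn_compact hΩ
  rw [hrestr]
  exact ⟨hint.comp_measurable hS, integral_map hS.aemeasurable hint.1⟩

/-- The function `k - f` integrated against `μ - σ`, for `σ` the push-forward of `ν` under
`otMap (f^c)`, is a supergradient of the dual functional at `f`. Indeed `y = otMap (f^c) x` attains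
the infimum in `f^c x` and is a competitor in `k^c x`, so `k^c x ≤ f^c x + f y - k y`. -/
lemma kantorovichDual_sub_le (hΩ : IsCompact Ω) (hne : Ω.Nonempty) [IsFiniteMeasure μ]
    [IsFiniteMeasure ν] (hνΩ : ν Ωᶜ = 0) (hν : ν ≪ volume) (hf : ContinuousOn f Ω)
    (hk : ContinuousOn k Ω) :
    kantorovichDual Ω μ ν k - kantorovichDual Ω μ ν f ≤
      (∫ x in Ω, (k x - f x) ∂μ) -
        ∫ x in Ω, (k x - f x) ∂(ν.map (otMap (cTransform Ω f))) := by
  obtain ⟨hi, he⟩ := integral_map_otMap hΩ hne hνΩ hν hf (hk.sub hf)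
  simp only [Pi.sub_apply] at he hi
  have hfb := hΩ.bddAbove_image hf
  have hkb := hΩ.bddAbove_image hk
  have hfc : IntegrableOn (cTransform Ω f) Ω ν :=
    (continuous_cTransform hΩ hne hfb).continuousOn.integrableOn_compact hΩ
  have hkc : IntegrableOn (cTransform Ω k) Ω ν :=
    (continuous_cTransform hΩ hne hkb).continuousOn.integrableOn_compact hΩ
  have hle : ∫ x in Ω, cTransform Ω k x ∂ν ≤ ∫ x in Ω, (cTransform Ω f x -
      (k (otMap (cTransform Ω f) x) - f (otMap (cTransform Ω f) x))) ∂ν := by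
    refine integral_mono_ae hkc (hfc.sub hi) (ae_restrict_of_ae ?_)
    filter_upwards [hν.ae_le (ae_otMap_cTransform hΩ hne hf)] with x hx
    have := cTransform_le hkb (x := x) hx.1
    linarith [hx.2]
  rw [integral_sub hfc hi] at hle
  rw [he, integral_sub (hk.integrableOn_compact hΩ) (hf.integrableOn_compact hΩ)]
  unfold kantorovichDual
  linarith

/-- The `Ḣ¹`-gradient represents the functional `h ↦ ∫ h d[μ - σ]`, for `σ` the push-forward of `ν`
under `otMap (f^c)`. As the Gateaux derivative exists, it is determined by the one-sided bound
`kantorovichDual_sub_le`, applied along `f + ε h` for both signs of `ε`. -/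
lemma IsHdotGradient.hdotInner_eq (hΩ : IsCompact Ω) (hne : Ω.Nonempty) [IsFiniteMeasure μ]
    [IsFiniteMeasure ν] (hνΩ : ν Ωᶜ = 0) (hν : ν ≪ volume) (hf : ContinuousOn f Ω)
    {g h : EuclideanSpace ℝ (Fin d) → ℝ} (hg : IsHdotGradient Ω μ ν f g)
    (hh : ContinuousOn h Ω) (hhm : MemHdot Ω h) :
    hdotInner Ω g h =
      (∫ x in Ω, h x ∂μ) - ∫ x in Ω, h x ∂(ν.map (otMap (cTransform Ω f))) := by
  set D := (∫ x in Ω, h x ∂μ) - ∫ x in Ω, h x ∂(ν.map (otMap (cTransform Ω f))) with hD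
  have hder := (hg.hasDerivAt h hh hhm).sub ((hasDerivAt_id (0 : ℝ)).mul_const D)
  have hmax : IsLocalMax ((fun ε : ℝ => kantorovichDual Ω μ ν (fun x => f x + ε * h x)) -
      fun ε => id ε * D) 0 := by
    refine Filter.Eventually.of_forall fun ε => ?_
    have := kantorovichDual_sub_le (μ := μ) hΩ hne hνΩ hν hf
      (hf.add ((continuousOn_const (c := ε)).mul hh))
    simp only [Pi.add_apply, Pi.mul_apply, add_sub_cancel_left, integral_const_mul] at this
    simp only [Pi.sub_apply, id, zero_mul, add_zero, sub_zero]
    have e : kantorovichDual Ω μ ν (f + (fun _ => ε) * h) =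
      kantorovichDual Ω μ ν (fun x => f x + ε * h x) := rfl
    rw [hD]
    linarith
  have := hmax.hasDerivAt_eq_zero hder
  linarith

/-! ### Calculus of weak gradients -/

section WeakGradient

variable {g : EuclideanSpace ℝ (Fin d) → ℝ}
  {G H : EuclideanSpace ℝ (Fin d) → EuclideanSpace ℝ (Fin d)}

lemma HasL2WeakGradient.congr_ae (h : HasL2WeakGradient Ω f G)
    (hfg : ∀ᵐ x ∂(volume.restrict Ω), g x = f x) : HasL2WeakGradient Ω g G where
  integrableOn := h.integrableOn.congr (hfg.mono fun _ hx => hx.symm)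
  memLp := h.memLp
  integral_eq φ hφ hφc hφs v := by
    rw [← h.integral_eq φ hφ hφc hφs v]
    exact integral_congr_ae (hfg.mono fun x hx => by simp only [hx])

lemma integrable_mul_fderiv (hf : IntegrableOn f Ω) {φ : EuclideanSpace ℝ (Fin d) → ℝ}
    (hφ : ContDiff ℝ ∞ φ) (hφc : HasCompactSupport φ) (v : EuclideanSpace ℝ (Fin d)) :
    IntegrableOn (fun x => f x * fderiv ℝ φ x v) Ω := by
  have hcont : Continuous (fun x => fderiv ℝ φ x v) :=
    (hφ.continuous_fderiv (by simp)).clm_apply continuous_const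
  obtain ⟨C, hC⟩ := (hφc.fderiv_apply ℝ v).exists_bound_of_continuous hcont
  exact hf.mul_bdd hcont.aestronglyMeasurable (Filter.Eventually.of_forall hC)

lemma HasL2WeakGradient.integrable_grad (hΩ : IsCompact Ω) (h : HasL2WeakGradient Ω f G) :
    IntegrableOn G Ω :=
  have : IsFiniteMeasure (volume.restrict Ω) := isFiniteMeasure_restrict.2 hΩ.measure_lt_top.ne
  h.memLp.integrable (by norm_num)

lemma integrable_smul_of_hasCompactSupport (hG : IntegrableOn G Ω)
    {φ : EuclideanSpace ℝ (Fin d) → ℝ} (hφ : ContDiff ℝ ∞ φ) (hφc : HasCompactSupport φ) :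
    IntegrableOn (fun x => φ x • G x) Ω := by
  obtain ⟨C, hC⟩ := hφc.exists_bound_of_continuous hφ.continuous
  exact hG.bdd_smul C hφ.continuous.aestronglyMeasurable (Filter.Eventually.of_forall hC)

lemma integrable_mul_inner (hG : IntegrableOn G Ω) {φ : EuclideanSpace ℝ (Fin d) → ℝ}
    (hφ : ContDiff ℝ ∞ φ) (hφc : HasCompactSupport φ) (v : EuclideanSpace ℝ (Fin d)) :
    IntegrableOn (fun x => φ x * inner ℝ (G x) v) Ω := by
  refine ((integrable_smul_of_hasCompactSupport hG hφ hφc).inner_const v).congr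
    (Filter.Eventually.of_forall fun x => ?_)
  simp only [real_inner_smul_left]

lemma HasL2WeakGradient.add_const_mul (hΩ : IsCompact Ω) (hf : HasL2WeakGradient Ω f G)
    (hg : HasL2WeakGradient Ω g H) (c : ℝ) :
    HasL2WeakGradient Ω (fun x => f x + c * g x) (G + c • H) where
  integrableOn := hf.integrableOn.add (hg.integrableOn.const_mul c)
  memLp := hf.memLp.add (hg.memLp.const_smul c)
  integral_eq φ hφ hφc hφs v := by
    have e1 : ∀ x, (f x + c * g x) * fderiv ℝ φ x v =
        f x * fderiv ℝ φ x v + c * (g x * fderiv ℝ φ x v) := fun x => by ring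
    have e2 : ∀ x, φ x * inner ℝ ((G + c • H) x) v =
        φ x * inner ℝ (G x) v + c * (φ x * inner ℝ (H x) v) := fun x => by
      simp only [Pi.add_apply, Pi.smul_apply, inner_add_left, real_inner_smul_left]
      ring
    simp only [e1, e2]
    rw [integral_add (integrable_mul_fderiv hf.integrableOn hφ hφc v)
        ((integrable_mul_fderiv hg.integrableOn hφ hφc v).const_mul c),
      integral_add (integrable_mul_inner (hf.integrable_grad hΩ) hφ hφc v)
        ((integrable_mul_inner (hg.integrable_grad hΩ) hφ hφc v).const_mul c),
      integral_const_mul, integral_const_mul, hf.integral_eq φ hφ hφc hφs v,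
      hg.integral_eq φ hφ hφc hφs v]
    ring

/-- Rademacher's theorem and integration by parts: the almost everywhere defined gradient of a
Lipschitz function is a weak gradient. -/
lemma hasL2WeakGradient_of_lipschitzWith (hΩ : IsCompact Ω) {C : NNReal}
    (hf : LipschitzWith C f) : HasL2WeakGradient Ω f (gradient f) where
  integrableOn := hf.continuous.continuousOn.integrableOn_compact hΩ
  memLp := by
    have : IsFiniteMeasure (volume.restrict Ω) := isFiniteMeasure_restrict.2 hΩ.measure_lt_top.ne
    refine MemLp.of_bound (measurable_gradient f).aestronglyMeasurable C
      (Filter.Eventually.of_forall fun x => ?_)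
    rw [gradient, LinearIsometryEquiv.norm_map]
    exact norm_fderiv_le_of_lipschitz ℝ hf
  integral_eq φ hφ hφc hφs v := by
    obtain ⟨D, hD⟩ := hφ.lipschitzWith_of_hasCompactSupport hφc (by simp)
    have hφΩ : ∀ x ∉ Ω, x ∉ tsupport φ := fun x hx hxs => hx (interior_subset (hφs hxs))
    rw [setIntegral_eq_integral_of_forall_compl_eq_zero fun x hx => by
        rw [fderiv_of_notMem_tsupport ℝ (hφΩ x hx)]; simp,
      setIntegral_eq_integral_of_forall_compl_eq_zero fun x hx => by
        rw [image_eq_zero_of_notMem_tsupport (hφΩ x hx), zero_mul]]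
    have h := hf.integral_lineDeriv_mul_eq (μ := volume) hD hφc v
    have e1 : ∫ x, lineDeriv ℝ f x v * φ x = ∫ x, φ x * inner ℝ (gradient f x) v := by
      refine integral_congr_ae ?_
      filter_upwards [hf.ae_differentiableAt (μ := volume)] with x hx
      rw [hx.lineDeriv_eq_fderiv, inner_gradient_left, mul_comm]
    have e2 : ∫ x, lineDeriv ℝ φ x (-v) * f x = -∫ x, f x * fderiv ℝ φ x v := by
      rw [← integral_neg]
      refine integral_congr_ae (Filter.Eventually.of_forall fun x => ?_)
      have hx : DifferentiableAt ℝ φ x := (hφ.differentiable (by simp)) x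
      simp only [hx.lineDeriv_eq_fderiv, map_neg]
      ring
    rw [e1, e2] at h
    rw [h, neg_neg]

/-- Weak gradients are determined almost everywhere on `Ω`: on the interior by the fundamental
lemma of the calculus of variations, and the boundary of a convex set is a null set. -/
lemma HasL2WeakGradient.ae_eq (hΩ : IsCompact Ω) (hconv : Convex ℝ Ω)
    (hG : HasL2WeakGradient Ω f G) (hH : HasL2WeakGradient Ω f H) :
    G =ᵐ[volume.restrict Ω] H := by
  have hint : IntegrableOn (G - H) Ω := (hG.integrable_grad hΩ).sub (hH.integrable_grad hΩ)
  have h0 : ∀ᵐ x ∂(volume.restrict Ω), x ∈ interior Ω → (G - H) x = 0 := by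
    refine isOpen_interior.ae_eq_zero_of_integral_contDiff_smul_eq_zero
      (hint.locallyIntegrable.locallyIntegrableOn _) fun φ hφ hφc hφs => ?_
    refine ext_inner_left ℝ fun v => ?_
    rw [← integral_inner (integrable_smul_of_hasCompactSupport hint hφ hφc), inner_zero_right]
    have e : ∀ x, inner ℝ v (φ x • (G - H) x) =
        φ x * inner ℝ (G x) v - φ x * inner ℝ (H x) v := fun x => by
      rw [real_inner_smul_right, Pi.sub_apply, inner_sub_right, real_inner_comm v (G x),
        real_inner_comm v (H x), mul_sub]
    simp only [e]
    rw [integral_sub (integrable_mul_inner (hG.integrable_grad hΩ) hφ hφc v)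
      (integrable_mul_inner (hH.integrable_grad hΩ) hφ hφc v)]
    have h1 := hG.integral_eq φ hφ hφc hφs v
    have h2 := hH.integral_eq φ hφ hφc hφs v
    linarith
  have hmem : ∀ᵐ x ∂(volume.restrict Ω), x ∈ interior Ω := by
    have hfr : ∀ᵐ x ∂(volume : Measure (EuclideanSpace ℝ (Fin d))), x ∉ frontier Ω :=
      measure_eq_zero_iff_ae_notMem.1 (hconv.addHaar_frontier volume)
    filter_upwards [ae_restrict_mem hΩ.measurableSet, ae_restrict_of_ae hfr] with x hx hxf
    by_contra hxi
    exact hxf ⟨subset_closure hx, hxi⟩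
  filter_upwards [h0, hmem] with x hx hxi
  exact sub_eq_zero.1 (hx hxi)

end WeakGradient

/-! ### The space `Ḣ¹` inside `L²` -/

lemma HasFiniteEnergy.hasL2WeakGradient_weakGradient (h : HasFiniteEnergy Ω f) :
    HasL2WeakGradient Ω f (weakGradient Ω f) := by
  unfold weakGradient
  rw [dif_pos (show ∃ G, HasL2WeakGradient Ω f G from h)]
  exact Exists.choose_spec _

lemma memLp_weakGradient (Ω : Set (EuclideanSpace ℝ (Fin d)))
    (f : EuclideanSpace ℝ (Fin d) → ℝ) : MemLp (weakGradient Ω f) 2 (volume.restrict Ω) := by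
  by_cases h : HasFiniteEnergy Ω f
  · exact h.hasL2WeakGradient_weakGradient.memLp
  · unfold weakGradient
    rw [dif_neg (show ¬ ∃ G, HasL2WeakGradient Ω f G from h)]
    exact MemLp.zero

/-- The weak gradient as an element of the Hilbert space `L²(Ω)`, which carries the inner product
and the norm of `Ḣ¹`. It is `0` for functions of infinite energy, in accordance with
`weakGradient`. -/
noncomputable def gradLp (Ω : Set (EuclideanSpace ℝ (Fin d))) (f : EuclideanSpace ℝ (Fin d) → ℝ) :
    Lp (EuclideanSpace ℝ (Fin d)) 2 (volume.restrict Ω) :=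
  (memLp_weakGradient Ω f).toLp _

lemma hdotInner_eq_inner_gradLp (f g : EuclideanSpace ℝ (Fin d) → ℝ) :
    hdotInner Ω f g = inner ℝ (gradLp Ω f) (gradLp Ω g) := by
  rw [L2.inner_def]
  refine integral_congr_ae ?_
  filter_upwards [(memLp_weakGradient Ω f).coeFn_toLp, (memLp_weakGradient Ω g).coeFn_toLp]
    with x hx hy
  rw [gradLp, gradLp, hx, hy]

lemma hdotNorm_eq_norm_gradLp (f : EuclideanSpace ℝ (Fin d) → ℝ) :
    hdotNorm Ω f = ‖gradLp Ω f‖ := by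
  rw [hdotNorm, hdotInner_eq_inner_gradLp, real_inner_self_eq_norm_sq, Real.sqrt_sq (norm_nonneg _)]

variable {g : EuclideanSpace ℝ (Fin d) → ℝ}
  {G : EuclideanSpace ℝ (Fin d) → EuclideanSpace ℝ (Fin d)}

lemma HasL2WeakGradient.gradLp_eq (hΩ : IsCompact Ω) (hconv : Convex ℝ Ω)
    (h : HasL2WeakGradient Ω f G) : gradLp Ω f = h.memLp.toLp G :=
  (MemLp.toLp_eq_toLp_iff _ _).2 <|
    HasL2WeakGradient.ae_eq hΩ hconv (HasFiniteEnergy.hasL2WeakGradient_weakGradient ⟨G, h⟩) h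

lemma gradLp_congr_ae (hΩ : IsCompact Ω) (hconv : Convex ℝ Ω) (hf : HasFiniteEnergy Ω f)
    (hfg : ∀ᵐ x ∂(volume.restrict Ω), g x = f x) : gradLp Ω g = gradLp Ω f := by
  obtain ⟨G, hG⟩ := hf
  rw [hG.gradLp_eq hΩ hconv, (hG.congr_ae hfg).gradLp_eq hΩ hconv]

lemma HasFiniteEnergy.congr_ae (hf : HasFiniteEnergy Ω f)
    (hfg : ∀ᵐ x ∂(volume.restrict Ω), g x = f x) : HasFiniteEnergy Ω g :=
  hf.imp fun _ h => h.congr_ae hfg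

lemma HasFiniteEnergy.add_const_mul (hΩ : IsCompact Ω) (hf : HasFiniteEnergy Ω f)
    (hg : HasFiniteEnergy Ω g) (c : ℝ) : HasFiniteEnergy Ω (fun x => f x + c * g x) :=
  ⟨_, hf.hasL2WeakGradient_weakGradient.add_const_mul hΩ hg.hasL2WeakGradient_weakGradient c⟩

lemma gradLp_add_const_mul (hΩ : IsCompact Ω) (hconv : Convex ℝ Ω) (hf : HasFiniteEnergy Ω f)
    (hg : HasFiniteEnergy Ω g) (c : ℝ) :
    gradLp Ω (fun x => f x + c * g x) = gradLp Ω f + c • gradLp Ω g :=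
  (hf.hasL2WeakGradient_weakGradient.add_const_mul hΩ
    hg.hasL2WeakGradient_weakGradient c).gradLp_eq hΩ hconv

lemma hasFiniteEnergy_one (hΩ : IsCompact Ω) : HasFiniteEnergy Ω (fun _ => 1) :=
  ⟨_, hasL2WeakGradient_of_lipschitzWith hΩ (LipschitzWith.const 1)⟩

lemma gradLp_one (hΩ : IsCompact Ω) (hconv : Convex ℝ Ω) : gradLp Ω (fun _ => 1) = 0 := by
  have h := hasL2WeakGradient_of_lipschitzWith hΩ (LipschitzWith.const (1 : ℝ))
  have h0 : gradient (fun _ : EuclideanSpace ℝ (Fin d) => (1 : ℝ)) = 0 :=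
    funext fun x => gradient_const x 1
  rw [h.gradLp_eq hΩ hconv]
  simp only [h0]
  exact MemLp.toLp_zero _

lemma IsCConcave.hasFiniteEnergy (hΩ : IsCompact Ω) (hne : Ω.Nonempty) (hf : IsCConcave Ω f) :
    HasFiniteEnergy Ω f := by
  obtain ⟨C, F, hF, hfF⟩ := hf.exists_lipschitzWith hΩ hne
  exact HasFiniteEnergy.congr_ae ⟨_, hasL2WeakGradient_of_lipschitzWith hΩ hF⟩
    ((ae_restrict_mem hΩ.measurableSet).mono fun x hx => hfF hx)

lemma IsCConcave.continuousOn (hΩ : IsCompact Ω) (hne : Ω.Nonempty) (hf : IsCConcave Ω f) :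
    ContinuousOn f Ω := by
  obtain ⟨C, F, hF, hfF⟩ := hf.exists_lipschitzWith hΩ hne
  exact hF.continuous.continuousOn.congr hfF

/-! ### Bounds for a single ascent step -/

section Step

variable {μ ν : Measure (EuclideanSpace ℝ (Fin d))}

/-- The dual norm of `μ - σ` is at most the `Ḣ¹`-norm of the gradient (Cauchy–Schwarz). -/
lemma IsHdotGradient.hdotDualNorm_le (hΩ : IsCompact Ω) (hne : Ω.Nonempty) [IsFiniteMeasure μ]
    [IsFiniteMeasure ν] (hνΩ : ν Ωᶜ = 0) (hν : ν ≪ volume) (hf : ContinuousOn f Ω)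
    (hg : IsHdotGradient Ω μ ν f g) :
    hdotDualNorm Ω μ (ν.map (otMap (cTransform Ω f))) ≤ ENNReal.ofReal ‖gradLp Ω g‖ := by
  refine iSup₂_le fun φ hφ => ENNReal.ofReal_le_ofReal ?_
  obtain ⟨hφc, hφm, hφ1⟩ := hφ
  rw [← hg.hdotInner_eq hΩ hne hνΩ hν hf hφc hφm, hdotInner_eq_inner_gradLp]
  rw [hdotNorm_eq_norm_gradLp] at hφ1
  exact (real_inner_le_norm _ _).trans (mul_le_of_le_one_right (norm_nonneg _) hφ1)

/-- If the gradient has a continuous representative `k`, then `k / ‖k‖` is admissible in the dual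
norm, which therefore is at least the `Ḣ¹`-norm of the gradient. -/
lemma IsHdotGradient.le_hdotDualNorm (hΩ : IsCompact Ω) (hconv : Convex ℝ Ω) (hne : Ω.Nonempty)
    [IsFiniteMeasure μ] [IsFiniteMeasure ν] (hνΩ : ν Ωᶜ = 0) (hν : ν ≪ volume)
    (hf : ContinuousOn f Ω) (hg : IsHdotGradient Ω μ ν f g) (hk : ContinuousOn k Ω)
    (hkg : ∀ᵐ x ∂(volume.restrict Ω), k x = g x) :
    ENNReal.ofReal ‖gradLp Ω g‖ ≤ hdotDualNorm Ω μ (ν.map (otMap (cTransform Ω f))) := by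
  rcases eq_or_ne (gradLp Ω g) 0 with h0 | h0
  · simp [h0]
  have hpos : 0 < ‖gradLp Ω g‖ := norm_pos_iff.2 h0
  set r := ‖gradLp Ω g‖
  have hkE : HasFiniteEnergy Ω k := hg.memHdot.1.congr_ae hkg
  have hφE : HasFiniteEnergy Ω (fun x => k x + (r⁻¹ - 1) * k x) :=
    hkE.add_const_mul hΩ hkE _
  have hφ : gradLp Ω (fun x => k x + (r⁻¹ - 1) * k x) = r⁻¹ • gradLp Ω g := by
    rw [gradLp_add_const_mul hΩ hconv hkE hkE, gradLp_congr_ae hΩ hconv hg.memHdot.1 hkg]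
    module
  have hφm : MemHdot Ω (fun x => k x + (r⁻¹ - 1) * k x) := by
    refine ⟨hφE, ?_⟩
    have e : ∀ x, k x + (r⁻¹ - 1) * k x = r⁻¹ * k x := fun x => by ring
    simp only [e]
    rw [integral_const_mul, integral_congr_ae hkg, hg.memHdot.2, mul_zero]
  have hφc : ContinuousOn (fun x => k x + (r⁻¹ - 1) * k x) Ω := hk.add (continuousOn_const.mul hk)
  refine le_trans (le_of_eq ?_) (le_iSup₂_of_le _ ⟨hφc, hφm, ?_⟩ le_rfl)
  · rw [← hg.hdotInner_eq hΩ hne hνΩ hν hf hφc hφm, hdotInner_eq_inner_gradLp, hφ,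
      real_inner_smul_right, real_inner_self_eq_norm_sq]
    congr 1
    change r = r⁻¹ * r ^ 2
    field_simp
  · rw [hdotNorm_eq_norm_gradLp, hφ, norm_smul, norm_inv, norm_norm]
    exact (inv_mul_cancel₀ hpos.ne').le

/-- Concavity of the dual functional: its increment is bounded by the `Ḣ¹`-gradient applied to the
increment of the argument. The latter may have nonzero mean, since adding a constant changes
neither `∫ h d[μ - σ]` nor the weak gradient. -/
lemma IsHdotGradient.kantorovichDual_sub_le_inner (hΩ : IsCompact Ω) (hconv : Convex ℝ Ω)
    [IsProbabilityMeasure μ] [IsProbabilityMeasure ν] (hμΩ : μ Ωᶜ = 0) (hνΩ : ν Ωᶜ = 0)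
    (hμ : μ ≪ volume) (hν : ν ≪ volume) (hf : ContinuousOn f Ω) (hfE : HasFiniteEnergy Ω f)
    (hk : ContinuousOn k Ω) (hkE : HasFiniteEnergy Ω k) (hg : IsHdotGradient Ω μ ν f g) :
    kantorovichDual Ω μ ν k - kantorovichDual Ω μ ν f ≤
      inner ℝ (gradLp Ω g) (gradLp Ω k - gradLp Ω f) := by
  have hμ1 : μ Ω = 1 := (prob_compl_eq_zero_iff hΩ.measurableSet).1 hμΩ
  have hν1 : ν Ω = 1 := (prob_compl_eq_zero_iff hΩ.measurableSet).1 hνΩ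
  have hvol : volume Ω ≠ 0 := fun h => by simp [hμ h] at hμ1
  have hvol' : volume.real Ω ≠ 0 := (ENNReal.toReal_pos hvol hΩ.measure_lt_top.ne).ne'
  have hne : Ω.Nonempty := nonempty_of_measure_ne_zero hvol
  have hdE : HasFiniteEnergy Ω (fun x => k x + (-1) * f x) := hkE.add_const_mul hΩ hfE _
  have hdc : ContinuousOn (fun x => k x + (-1) * f x) Ω := hk.add (continuousOn_const.mul hf)
  set c := -((volume.real Ω)⁻¹ * ∫ x in Ω, (k x + (-1) * f x))
  have hhE : HasFiniteEnergy Ω (fun x => k x + (-1) * f x + c * 1) :=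
    hdE.add_const_mul hΩ (hasFiniteEnergy_one hΩ) c
  have hhc : ContinuousOn (fun x => k x + (-1) * f x + c * 1) Ω := hdc.add continuousOn_const
  have hhm : MemHdot Ω (fun x => k x + (-1) * f x + c * 1) := by
    refine ⟨hhE, ?_⟩
    rw [integral_add (hdc.integrableOn_compact hΩ) (continuousOn_const.integrableOn_compact hΩ),
      setIntegral_const, smul_eq_mul]
    simp only [c]
    field_simp
    ring
  have hgrad : gradLp Ω (fun x => k x + (-1) * f x + c * 1) = gradLp Ω k - gradLp Ω f := by
    rw [gradLp_add_const_mul hΩ hconv hdE (hasFiniteEnergy_one hΩ),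
      gradLp_add_const_mul hΩ hconv hkE hfE, gradLp_one hΩ hconv]
    module
  have hkey := kantorovichDual_sub_le (μ := μ) hΩ hne hνΩ hν hf hk
  have hrep := hg.hdotInner_eq hΩ hne hνΩ hν hf hhc hhm
  have hS : IsFiniteMeasure (ν.map (otMap (cTransform Ω f))) := Measure.isFiniteMeasure_map ν _
  have hone : ∫ x in Ω, c * 1 ∂(ν.map (otMap (cTransform Ω f))) = c := by
    rw [(integral_map_otMap hΩ hne hνΩ hν hf
      (continuousOn_const (c := c * 1))).2, setIntegral_const, measureReal_def, hν1]
    simp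
  rw [hdotInner_eq_inner_gradLp, hgrad,
    integral_add (hdc.integrableOn_compact hΩ) (continuousOn_const.integrableOn_compact hΩ),
    integral_add (hdc.integrableOn_compact hΩ) (continuousOn_const.integrableOn_compact hΩ),
    hone, setIntegral_const, measureReal_def, hμ1] at hrep
  simp only [neg_one_mul, ← sub_eq_add_neg, ENNReal.toReal_one, one_smul, mul_one] at hrep
  linarith

end Step

end SGA

/-! ### The telescoping sum -/

open SGA in
theorem theorem1 {d : ℕ} (Ω : Set (EuclideanSpace ℝ (Fin d)))
    (hΩ_compact : IsCompact Ω) (hΩ_convex : Convex ℝ Ω)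
    (μ ν : MeasureTheory.Measure (EuclideanSpace ℝ (Fin d)))
    [MeasureTheory.IsProbabilityMeasure μ] [MeasureTheory.IsProbabilityMeasure ν]
    (hμΩ : μ Ωᶜ = 0) (hνΩ : ν Ωᶜ = 0)
    (hμ : μ.AbsolutelyContinuous MeasureTheory.volume)
    (hν : ν.AbsolutelyContinuous MeasureTheory.volume)
    (T : ℕ) (η : ℕ → ℝ) (hη : ∀ t < T, 0 ≤ η t) (hη_sum : 0 < ∑ t ∈ Finset.range T, η t)
    (f : ℕ → EuclideanSpace ℝ (Fin d) → ℝ)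
    (hf_cont : ∀ t ≤ T, ContinuousOn (f t) Ω)
    (hf_init : SGA.HasFiniteEnergy Ω (f 0))
    (hf : SGA.IsSobolevAscent Ω μ ν η T f)
    (fOpt : EuclideanSpace ℝ (Fin d) → ℝ) (hfOpt : SGA.IsCConcaveMaximizer Ω μ ν fOpt)
    (fBest : EuclideanSpace ℝ (Fin d) → ℝ)
    (hfBest : ∀ t < T, SGA.kantorovichDual Ω μ ν (f t) ≤ SGA.kantorovichDual Ω μ ν fBest) :
    SGA.ascentBound Ω μ ν T f ≠ ⊤ ∧
      SGA.kantorovichDual Ω μ ν fOpt - SGA.kantorovichDual Ω μ ν fBest ≤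
        (SGA.hdotNorm Ω (fun x => f 0 x - fOpt x) ^ 2 +
            (SGA.ascentBound Ω μ ν T f).toReal ^ 2 * ∑ t ∈ Finset.range T, η t ^ 2) /
          (2 * ∑ t ∈ Finset.range T, η t) := by
  have hμ1 : μ Ω = 1 := (prob_compl_eq_zero_iff hΩ_compact.measurableSet).1 hμΩ
  have hne : Ω.Nonempty := nonempty_of_measure_ne_zero (μ := μ) (by simp [hμ1])
  have hoptE := hfOpt.1.hasFiniteEnergy hΩ_compact hne
  have hoptC := hfOpt.1.continuousOn hΩ_compact hne
  choose! g hg hstep using hf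
  have hfin : ascentBound Ω μ ν T f ≠ ⊤ := by
    refine ((Finset.sup_lt_iff ENNReal.zero_lt_top).2 fun t ht => ?_).ne
    have ht := Finset.mem_range.1 ht
    exact ((hg t ht).hdotDualNorm_le hΩ_compact hne hνΩ hν (hf_cont t ht.le)).trans_lt
      ENNReal.ofReal_lt_top
  refine ⟨hfin, ?_⟩
  have hfE : ∀ t ≤ T, HasFiniteEnergy Ω (f t) := by
    intro t
    induction t with
    | zero => exact fun _ => hf_init
    | succ t ih =>
      intro ht
      exact ((ih (by omega)).add_const_mul hΩ_compact (hg t ht).memHdot.1 (η t)).congr_ae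
        (hstep t ht)
  set M := (ascentBound Ω μ ν T f).toReal
  set δ := kantorovichDual Ω μ ν fOpt - kantorovichDual Ω μ ν fBest
  have hone : ∀ t < T, ‖gradLp Ω (f (t + 1)) - gradLp Ω fOpt‖ ^ 2 ≤
      ‖gradLp Ω (f t) - gradLp Ω fOpt‖ ^ 2 - 2 * η t * δ + M ^ 2 * η t ^ 2 := by
    intro t ht
    have hrec : gradLp Ω (f (t + 1)) = gradLp Ω (f t) + η t • gradLp Ω (g t) := by
      rw [gradLp_congr_ae hΩ_compact hΩ_convex
        ((hfE t ht.le).add_const_mul hΩ_compact (hg t ht).memHdot.1 (η t)) (hstep t ht),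
        gradLp_add_const_mul hΩ_compact hΩ_convex (hfE t ht.le) (hg t ht).memHdot.1]
    have hgap : δ ≤ inner ℝ (gradLp Ω (g t)) (gradLp Ω fOpt - gradLp Ω (f t)) := by
      have := (hg t ht).kantorovichDual_sub_le_inner hΩ_compact hΩ_convex hμΩ hνΩ hμ hν
        (hf_cont t ht.le) (hfE t ht.le) hoptC hoptE
      linarith [hfBest t ht]
    -- For `η t = 0` the gradient need not have a continuous representative, but is not needed.
    have hM : η t ^ 2 * ‖gradLp Ω (g t)‖ ^ 2 ≤ M ^ 2 * η t ^ 2 := by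
      rcases (hη t ht).eq_or_lt with h0 | hpos
      · simp [← h0]
      have hkc : ContinuousOn (fun x => (f (t + 1) x - f t x) / η t) Ω :=
        ((hf_cont (t + 1) ht).sub (hf_cont t ht.le)).div_const _
      have hkg : ∀ᵐ x ∂(volume.restrict Ω), (f (t + 1) x - f t x) / η t = g t x := by
        filter_upwards [hstep t ht] with x hx
        rw [hx, add_sub_cancel_left, mul_div_cancel_left₀ _ hpos.ne']
      have hle := ((hg t ht).le_hdotDualNorm hΩ_compact hΩ_convex hne hνΩ hν (hf_cont t ht.le)
        hkc hkg).trans (Finset.le_sup (f := fun s =>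
          hdotDualNorm Ω μ (ν.map (otMap (cTransform Ω (f s))))) (Finset.mem_range.2 ht))
      have hle' : ‖gradLp Ω (g t)‖ ≤ M := (ENNReal.ofReal_le_iff_le_toReal hfin).1 hle
      rw [mul_comm]
      gcongr
    have hexp := norm_add_sq_real (gradLp Ω (f t) - gradLp Ω fOpt) (η t • gradLp Ω (g t))
    rw [real_inner_smul_right, real_inner_comm, ← neg_sub (gradLp Ω fOpt), inner_neg_right,
      norm_neg, norm_smul, mul_pow, Real.norm_eq_abs, sq_abs] at hexp
    have hη' := mul_le_mul_of_nonneg_left hgap (hη t ht)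
    have e : gradLp Ω (f (t + 1)) - gradLp Ω fOpt =
        -(gradLp Ω fOpt - gradLp Ω (f t)) + η t • gradLp Ω (g t) := by
      rw [hrec]; abel
    rw [e, hexp, norm_sub_rev (gradLp Ω (f t))]
    linarith
  have htel : ∀ n ≤ T, ‖gradLp Ω (f n) - gradLp Ω fOpt‖ ^ 2 ≤
      ‖gradLp Ω (f 0) - gradLp Ω fOpt‖ ^ 2 - 2 * (∑ t ∈ Finset.range n, η t) * δ +
        M ^ 2 * ∑ t ∈ Finset.range n, η t ^ 2 := by
    intro n
    induction n with
    | zero => simp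
    | succ n ih =>
      intro hn
      rw [Finset.sum_range_succ, Finset.sum_range_succ]
      linarith [ih (by omega), hone n hn]
  have hnorm : hdotNorm Ω (fun x => f 0 x - fOpt x) = ‖gradLp Ω (f 0) - gradLp Ω fOpt‖ := by
    have e : (fun x => f 0 x - fOpt x) = fun x => f 0 x + (-1) * fOpt x := by
      funext x; ring
    rw [hdotNorm_eq_norm_gradLp, e, gradLp_add_const_mul hΩ_compact hΩ_convex hf_init hoptE,
      neg_one_smul, sub_eq_add_neg]
  rw [hnorm, le_div_iff₀ (by positivity)]
  have := htel T le_rfl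
  have := sq_nonneg ‖gradLp Ω (f T) - gradLp Ω fOpt‖
  linarith
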